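/- All rings are commutative and Noetherian. Let $R=\bigoplus_{n\in\mathbb Z}R_n$ be a $\mathbb{Z}$-graded ring; graded maps of graded modules preserve degrees, and $M(n)$ denotes the shift with $M(n)_i=M_{i+n}$. Suppose that $R$ is $^*$local, i.e. it has a unique maximal element $\mathfrak m$ among its proper graded ideals, and that $k=R/\mathfrak m$ is a field. A graded module is $^*$injective if it is an injective object in the category of graded $R$-modules and graded maps, $^*$free if it has a basis of homogeneous elements, and $^*$Noetherian if it satisfies the ascending chain condition on graded submodules. A graded module $N$ is a $^*$essential extension of a graded submodule $L$ if every nonzero graded submodule of $N$ meets $L$ nontrivially, and the $^*$injective hull ${}^*E_R(L)$ is the (up to isomorphism unique) $^*$essential extension of $L$ that is $^*$injective. Put $$\underline{\mathrm{Hom}}_R(M,N)=\bigoplus_{n\in\mathbb Z}\mathrm{Hom}_{\mathrm{gr}}(M,N(n)),\qquad M^\vee_{\mathrm{gr}}=\underline{\mathrm{Hom}}_R\bigl(M,{}^*E_R(R/\mathfrak m)\bigr).$$ Let $M$ be a $^*$Noetherian graded $R$-module with a minimal $^*$free resolution $F_\bullet\to M$, that is, an exact sequence $\cdots\to F_1\to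 F_0\to M\to 0$ of graded maps in which all $F_i$ are $^*$free and $\operatorname{im}(F_{i+1}\to F_i)\subseteq\mathfrak m F_i$ for all $i\ge 0$. Then $$0\to M^\vee_{\mathrm{gr}}\to (F_0)^\vee_{\mathrm{gr}}\to (F_1)^\vee_{\mathrm{gr}}\to\cdots$$ is a minimal $^*$injective resolution of $M^\vee_{\mathrm{gr}}$: it is exact, every $(F_i)^\vee_{\mathrm{gr}}$ is $^*$injective, $(F_0)^\vee_{\mathrm{gr}}$ is a $^*$essential extension of the image of $M^\vee_{\mathrm{gr}}$, and $(F_{i+1})^\vee_{\mathrm{gr}}$ is a $^*$essential extension of the image of $(F_i)^\vee_{\mathrm{gr}}$ for all $i\ge 0$. In particular, for all $i\ge 0$ and all $z\in\mathbb Z$, $$\beta(i,M,-z)={}^*\mu(i,\mathfrak m,z,M^\vee_{\mathrm{gr}}).$$ Here the graded Betti number $\beta(i,M,a)$ is the number of summands $R(-a)$ in a decomposition of the $i$-th term of a minimal $^*$free resolution of $M$ as a direct sum of shifts of $R$, and, for a graded module $N$, the graded Bass number ${}^*\mu(i,\mathfrak m,z,N)$ is the number of summands ${}^*E_R(R/\mathfrak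 m)(-z)$ in a decomposition of the $i$-th term of a minimal $^*$injective resolution of $N$ as a direct sum of modules ${}^*E_R(R/\mathfrak q)(-j)$ with $\mathfrak q$ a graded prime ideal and $j\in\mathbb Z$. For the modules $M$ and $N=M^\vee_{\mathrm{gr}}$ at hand such decompositions exist, and these numbers do not depend on the choice of resolution or decomposition. -/

import Mathlib

universe u

namespace GradedMatlis

/-- A criterion for a family of subgroups to be an internal direct sum decomposition. -/
theorem isInternal_of_separating {M T : Type*} [AddCommGroup M] [AddCommGroup T]
    (A : ℤ → AddSubgroup M) (htop : ∀ x : M, x ∈ ⨆ i, A i)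
    (hsep : ∀ i, ∀ x ∈ A i, x ≠ 0 →
      ∃ q : M →+ T, q x ≠ 0 ∧ ∀ j, j ≠ i → ∀ y ∈ A j, q y = 0) :
    DirectSum.IsInternal A := by
  classical
  constructor
  · rw [injective_iff_map_eq_zero]
    intro x hx
    by_contra hne
    obtain ⟨i, hi⟩ : ∃ i, x i ≠ 0 := by
      by_contra! h
      exact hne (DFinsupp.ext h)
    obtain ⟨q, hq, hq'⟩ := hsep i (x i) (x i).2 (by simpa using hi)
    apply hq
    have h1 : q (DirectSum.coeAddMonoidHom A x) = 0 := by rw [hx, map_zero]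
    rw [DirectSum.coeAddMonoidHom_eq_dfinsuppSum, DFinsupp.sum, map_sum,
      Finset.sum_eq_single i] at h1
    · exact h1
    · intro j _ hj
      exact hq' j hj _ (x j).2
    · intro hi'
      simp only [DFinsupp.mem_support_toFun, ne_eq, not_not] at hi'
      simp [hi']
  · intro x
    have hle : (⨆ i, A i) ≤ (DirectSum.coeAddMonoidHom A).range := by
      apply iSup_le
      intro i y hy
      exact ⟨DirectSum.of (fun i => A i) i ⟨y, hy⟩, by simp⟩
    exact hle (htop x)

/-- A `ℤ`-graded module over the `ℤ`-graded ring `(R, 𝒜)`. -/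
structure GrMod {R : Type u} [CommRing R] (𝒜 : ℤ → AddSubgroup R) where
  /-- the underlying module -/
  carrier : Type u
  [addCommGroup : AddCommGroup carrier]
  [module : Module R carrier]
  /-- the graded pieces -/
  gr : ℤ → AddSubgroup carrier
  [decomposition : DirectSum.Decomposition gr]
  [gradedSMul : SetLike.GradedSMul 𝒜 gr]

namespace GrMod

variable {R : Type u} [CommRing R] {𝒜 : ℤ → AddSubgroup R}

instance : CoeSort (GrMod 𝒜) (Type u) := ⟨GrMod.carrier⟩

attribute [instance] GrMod.addCommGroup GrMod.module GrMod.decomposition GrMod.gradedSMul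

theorem mem_iSup_gr (M : GrMod 𝒜) (x : M) : x ∈ ⨆ i, M.gr i := by
  classical
  rw [← DirectSum.sum_support_decompose M.gr x]
  exact sum_mem fun i _ => AddSubgroup.mem_iSup_of_mem i (SetLike.coe_mem _)

theorem smul_mem (M : GrMod 𝒜) {i j : ℤ} {r : R} {x : M} (hr : r ∈ 𝒜 i) (hx : x ∈ M.gr j) :
    r • x ∈ M.gr (i + j) := SetLike.GradedSMul.smul_mem hr hx

/-- Projection to the `i`-th graded piece. -/
noncomputable def proj (M : GrMod 𝒜) (i : ℤ) : M →+ M where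
  toFun x := (DirectSum.decompose M.gr x i : M)
  map_zero' := by simp
  map_add' := by simp

theorem proj_same (M : GrMod 𝒜) {i : ℤ} {x : M} (hx : x ∈ M.gr i) : M.proj i x = x :=
  DirectSum.decompose_of_mem_same M.gr hx

theorem proj_ne (M : GrMod 𝒜) {i j : ℤ} {x : M} (hx : x ∈ M.gr j) (h : j ≠ i) :
    M.proj i x = 0 :=
  DirectSum.decompose_of_mem_ne M.gr hx h

/-- A graded map: an `R`-linear map `f : M → N` with `f (M_i) ⊆ N_i` for all `i`. -/
structure Hom (M N : GrMod 𝒜) where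
  /-- the underlying `R`-linear map -/
  toLin : M →ₗ[R] N
  map_mem : ∀ i, ∀ x ∈ M.gr i, toLin x ∈ N.gr i

/-- The shift `M(n)`, with `M(n)_i = M_{i+n}`. -/
noncomputable def shift (M : GrMod 𝒜) (n : ℤ) : GrMod 𝒜 :=
  letI : DirectSum.Decomposition (fun i : ℤ => M.gr (i + n)) :=
    (isInternal_of_separating (T := M) _
      (fun x => by
        have hle : (⨆ i, M.gr i) ≤ ⨆ i, M.gr (i + n) := by
          refine iSup_le fun i => ?_
          have h := le_iSup (fun i : ℤ => M.gr (i + n)) (i - n)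
          simpa using h
        exact hle (M.mem_iSup_gr x))
      (fun i x hx hne => ⟨M.proj (i + n), by rwa [M.proj_same hx],
        fun j hj y hy => M.proj_ne hy (by simpa using hj)⟩)).chooseDecomposition
  haveI : SetLike.GradedSMul 𝒜 (fun i : ℤ => M.gr (i + n)) :=
    ⟨fun {i j r x} hr hx => by
      have := M.smul_mem hr hx
      rwa [← add_assoc] at this⟩
  { carrier := M
    gr := fun i => M.gr (i + n) }

section Hom

variable (M N : GrMod 𝒜)

/-- `R`-linear maps `f : M → N` that are homogeneous of degree `n`, i.e. `f (M_i) ⊆ N_{i+n}`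
for all `i`; these are the graded maps `M → N(n)`. -/
def homDeg (n : ℤ) : AddSubgroup (M →ₗ[R] N) where
  carrier := {f | ∀ i, ∀ x ∈ M.gr i, f x ∈ N.gr (i + n)}
  zero_mem' := fun _ _ _ => zero_mem _
  add_mem' := fun hf hg i x hx => add_mem (hf i x hx) (hg i x hx)
  neg_mem' := fun hf i x hx => neg_mem (hf i x hx)

theorem homDeg_smul {i n : ℤ} {r : R} {f : M →ₗ[R] N} (hr : r ∈ 𝒜 i) (hf : f ∈ homDeg M N n) :
    r • f ∈ homDeg M N (i + n) := by
  intro j x hx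
  have := N.smul_mem hr (hf j x hx)
  rwa [show i + (j + n) = j + (i + n) by ring] at this

variable [GradedRing 𝒜]

/-- The submodule of `Hom_R(M, N)` of all finite sums of homogeneous maps: the (internal)
direct sum over `n` of the groups of graded maps `M → N(n)`. -/
def starHomSubmodule : Submodule R (M →ₗ[R] N) where
  carrier := {f | f ∈ ⨆ n, homDeg M N n}
  zero_mem' := zero_mem (⨆ n, homDeg M N n)
  add_mem' := fun {f g} (hf : f ∈ ⨆ n, homDeg M N n) (hg : g ∈ ⨆ n, homDeg M N n) =>
    (add_mem hf hg : f + g ∈ ⨆ n, homDeg M N n)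
  smul_mem' := fun r f hf => by
    change r • f ∈ ⨆ n, homDeg M N n
    change f ∈ ⨆ n, homDeg M N n at hf
    induction hf using AddSubgroup.iSup_induction' with
    | h1 => simp
    | hadd f g _ _ hf hg => rw [smul_add]; exact add_mem hf hg
    | hp n f hf =>
      induction r using DirectSum.Decomposition.inductionOn 𝒜 with
      | zero => simp
      | add r s hr hs => rw [add_smul]; exact add_mem hr hs
      | homogeneous r =>
        exact AddSubgroup.mem_iSup_of_mem _ (homDeg_smul M N r.2 hf)

theorem mem_starHomSubmodule_iff {f : M →ₗ[R] N} :
    f ∈ starHomSubmodule M N ↔ f ∈ ⨆ n, homDeg M N n := Iff.rfl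

theorem mem_starHomSubmodule_of_homDeg {n : ℤ} {f : M →ₗ[R] N} (hf : f ∈ homDeg M N n) :
    f ∈ starHomSubmodule M N :=
  (mem_starHomSubmodule_iff M N).2 (AddSubgroup.mem_iSup_of_mem n hf)

/-- The degree `n` piece of the graded module of homomorphisms. -/
def starHomGr (n : ℤ) : AddSubgroup (starHomSubmodule M N) :=
  (homDeg M N n).comap (starHomSubmodule M N).subtype.toAddMonoidHom

theorem starHom_isInternal : DirectSum.IsInternal (starHomGr M N) := by
  refine isInternal_of_separating (T := N) _ ?_ ?_
  · rintro ⟨f, hf⟩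
    have hf' := (mem_starHomSubmodule_iff M N).1 hf
    induction hf' using AddSubgroup.iSup_induction' with
    | h1 => exact zero_mem (⨆ i, starHomGr M N i)
    | hadd f g hf1 hg1 hf2 hg2 => exact add_mem (hf2 hf1) (hg2 hg1)
    | hp n f hf1 => exact AddSubgroup.mem_iSup_of_mem n hf1
  · rintro i ⟨f, hf⟩ hfi hne
    have hfi' : f ∈ homDeg M N i := hfi
    obtain ⟨j, y, hy, hfy⟩ : ∃ j, ∃ y ∈ M.gr j, f y ≠ 0 := by
      by_contra! h
      apply hne
      ext y
      change f y = 0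
      induction M.mem_iSup_gr y using AddSubgroup.iSup_induction' with
      | h1 => simp
      | hadd a b _ _ ha hb => rw [map_add, ha, hb, add_zero]
      | hp n a ha => exact h n a ha
    refine ⟨(N.proj (j + i)).comp
      ((LinearMap.applyₗ y).toAddMonoidHom.comp (starHomSubmodule M N).subtype.toAddMonoidHom),
      ?_, ?_⟩
    · change N.proj (j + i) (f y) ≠ 0
      rwa [N.proj_same (hfi' j y hy)]
    · rintro k hk ⟨g, hg⟩ hgk
      change N.proj (j + i) (g y) = 0
      have hgk' : g ∈ homDeg M N k := hgk
      exact N.proj_ne (hgk' j y hy) (by simpa using hk)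

/-- The graded module `*Hom_R(M, N) = ⨁_n Hom(M, N(n))` of homomorphisms; its piece of degree `n`
consists of the homogeneous maps of degree `n`. -/
noncomputable def starHom : GrMod 𝒜 :=
  letI : DirectSum.Decomposition (starHomGr M N) := (starHom_isInternal M N).chooseDecomposition
  haveI : SetLike.GradedSMul 𝒜 (starHomGr M N) :=
    ⟨fun {_ _ _ _} hr hf => homDeg_smul M N hr hf⟩
  { carrier := starHomSubmodule M N
    gr := starHomGr M N }

end Hom

section Precomp

variable {M M' : GrMod 𝒜}

theorem comp_mem_homDeg (g : Hom M M') (N : GrMod 𝒜) {n : ℤ} {f : M' →ₗ[R] N}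
    (hf : f ∈ homDeg M' N n) : f.comp g.toLin ∈ homDeg M N n :=
  fun i x hx => hf i _ (g.map_mem i x hx)

variable [GradedRing 𝒜]

theorem comp_mem_starHomSubmodule (g : Hom M M') (N : GrMod 𝒜) {f : M' →ₗ[R] N}
    (hf : f ∈ starHomSubmodule M' N) : f.comp g.toLin ∈ starHomSubmodule M N := by
  have hf' := (mem_starHomSubmodule_iff M' N).1 hf
  induction hf' using AddSubgroup.iSup_induction' with
  | h1 => rw [LinearMap.zero_comp]; exact zero_mem _
  | hadd a b ha hb ha' hb' => rw [LinearMap.add_comp]; exact add_mem (ha' ha) (hb' hb)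
  | hp n a ha => exact mem_starHomSubmodule_of_homDeg M N (comp_mem_homDeg g N ha)

/-- Functoriality of `*Hom_R(-, N)`: the graded map `f ↦ f ∘ g`. -/
noncomputable def starHomMap (g : Hom M M') (N : GrMod 𝒜) :
    Hom (starHom M' N) (starHom M N) where
  toLin := (LinearMap.lcomp R N g.toLin).restrict
    (p := starHomSubmodule M' N) (q := starHomSubmodule M N)
    (fun _ hf => comp_mem_starHomSubmodule g N hf)
  map_mem := fun _ _ hf => comp_mem_homDeg g N hf

end Precomp

section Quotient

variable [GradedRing 𝒜]

/-- The graded pieces of `R ⧸ I`: the images of the graded pieces of `R`. -/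
def quotGr (I : HomogeneousIdeal 𝒜) (i : ℤ) : AddSubgroup (R ⧸ I.toIdeal) :=
  (𝒜 i).map (Ideal.Quotient.mk I.toIdeal).toAddMonoidHom

theorem quot_isInternal (I : HomogeneousIdeal 𝒜) : DirectSum.IsInternal (quotGr I) := by
  refine isInternal_of_separating (T := R ⧸ I.toIdeal) _ ?_ ?_
  · intro x
    obtain ⟨r, rfl⟩ := Ideal.Quotient.mk_surjective x
    induction r using DirectSum.Decomposition.inductionOn 𝒜 with
    | zero => rw [map_zero]; exact zero_mem _
    | add r s hr hs => rw [map_add]; exact add_mem hr hs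
    | homogeneous r => exact AddSubgroup.mem_iSup_of_mem _ ⟨r, r.2, rfl⟩
  · rintro i _ ⟨r, hr, rfl⟩ hne
    refine ⟨QuotientAddGroup.map I.toIdeal.toAddSubgroup I.toIdeal.toAddSubgroup
      (GradedRing.proj 𝒜 i) (fun x hx => I.isHomogeneous i hx), ?_, ?_⟩
    · change Ideal.Quotient.mk I.toIdeal (GradedRing.proj 𝒜 i r) ≠ 0
      rw [GradedRing.proj_apply, DirectSum.decompose_of_mem_same 𝒜 hr]
      exact hne
    · rintro j hj _ ⟨s, hs, rfl⟩
      change Ideal.Quotient.mk I.toIdeal (GradedRing.proj 𝒜 i s) = 0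
      rw [GradedRing.proj_apply, DirectSum.decompose_of_mem_ne 𝒜 hs hj, map_zero]

/-- The graded module `R / I` for a graded ideal `I`. -/
noncomputable def quot (I : HomogeneousIdeal 𝒜) : GrMod 𝒜 :=
  letI : DirectSum.Decomposition (quotGr I) := (quot_isInternal I).chooseDecomposition
  haveI : SetLike.GradedSMul 𝒜 (quotGr I) :=
    ⟨fun {i j r x} hr hx => by
      obtain ⟨s, hs, rfl⟩ := hx
      exact ⟨r * s, SetLike.mul_mem_graded hr hs, rfl⟩⟩
  { carrier := R ⧸ I.toIdeal
    gr := quotGr I }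

end Quotient

section Properties

variable [GradedRing 𝒜]

/-- *Noetherian: every ascending chain of graded submodules becomes stationary. -/
def IsStarNoetherian (M : GrMod 𝒜) : Prop :=
  ∀ c : ℕ →o HomogeneousSubmodule 𝒜 M.gr, ∃ n, ∀ k, n ≤ k → c n = c k

/-- *injective: graded maps into `E` extend along injective graded maps, i.e. `E` is an injective
object of the category of graded modules. -/
def IsStarInjective (E : GrMod 𝒜) : Prop :=
  ∀ (A B : GrMod 𝒜) (i : Hom A B) (f : Hom A E), Function.Injective i.toLin →
    ∃ g : Hom B E, ∀ a, g.toLin (i.toLin a) = f.toLin a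

/-- `N` is a *essential extension of its submodule `L`: every nonzero graded submodule of `N`
meets `L` nontrivially. -/
def IsStarEssential (N : GrMod 𝒜) (L : Submodule R N) : Prop :=
  ∀ U : HomogeneousSubmodule 𝒜 N.gr, U.toSubmodule ≠ ⊥ → U.toSubmodule ⊓ L ≠ ⊥

/-- `φ : M → E` exhibits `E` as a *injective hull `*E_R(M)` of `M`: it is an injective graded map,
`E` is *injective, and `E` is a *essential extension of the image of `M`. -/
structure IsStarInjectiveHull {M E : GrMod 𝒜} (φ : Hom M E) : Prop where
  injective : Function.Injective φ.toLin
  starInjective : E.IsStarInjective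
  essential : E.IsStarEssential (LinearMap.range φ.toLin)

/-- `H` is a *injective hull `*E_R(M)` of `M`. -/
def IsHullOf (H M : GrMod 𝒜) : Prop := ∃ φ : Hom M H, IsStarInjectiveHull φ

/-- A basis of `F` consisting of homogeneous elements, with `deg j` the degree of the `j`-th basis
element; it amounts to an isomorphism of `F` with the direct sum of the `R(-deg j)`. -/
structure HomogeneousBasis (F : GrMod 𝒜) (J : Type u) where
  /-- the basis -/
  basis : Module.Basis J R F
  /-- the degrees of the basis elements -/
  deg : J → ℤ
  mem : ∀ j, basis j ∈ F.gr (deg j)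

/-- *free: there is a basis of homogeneous elements. -/
def IsStarFree (F : GrMod 𝒜) : Prop := ∃ J : Type u, Nonempty (F.HomogeneousBasis J)

/-- A decomposition of `E` as a direct sum, indexed by `J`, of *injective hulls
`*E_R((R/𝔮)(-k))` with `𝔮` a graded prime and `k` an integer (both depending on the index). -/
structure HullDecomposition (E : GrMod 𝒜) (J : Type u) where
  /-- the summands -/
  summand : J → GrMod 𝒜
  /-- the inclusions of the summands -/
  incl : ∀ j, Hom (summand j) E
  isHull : ∀ j, ∃ (q : HomogeneousIdeal 𝒜) (k : ℤ), q.toIdeal.IsPrime ∧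
    (summand j).IsHullOf ((quot q).shift (-k))
  bijective : letI := Classical.decEq J
    Function.Bijective (DirectSum.toModule R J E (fun j => (incl j).toLin))

end Properties

end GrMod

open GrMod

variable {R : Type u} [CommRing R] {𝒜 : ℤ → AddSubgroup R} [GradedRing 𝒜]

/-- The graded ring `R` is *local with *maximal ideal `m`: the graded ideal `m` is the unique
maximal element among the proper graded ideals. -/
def IsStarLocal (m : HomogeneousIdeal 𝒜) : Prop :=
  IsCoatom m ∧ ∀ n : HomogeneousIdeal 𝒜, IsCoatom n → n = m

/-- Graded modules and graded maps `⋯ → X 1 → X 0 → M`. -/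
structure LeftSeq (M : GrMod 𝒜) where
  /-- the modules -/
  X : ℕ → GrMod 𝒜
  /-- the differentials -/
  d : ∀ i, Hom (X (i + 1)) (X i)
  /-- the augmentation -/
  aug : Hom (X 0) M

/-- Graded modules and graded maps `N → X 0 → X 1 → ⋯`. -/
structure RightSeq (N : GrMod 𝒜) where
  /-- the modules -/
  X : ℕ → GrMod 𝒜
  /-- the differentials -/
  d : ∀ i, Hom (X i) (X (i + 1))
  /-- the augmentation -/
  aug : Hom N (X 0)

/-- `⋯ → F 1 → F 0 → M → 0` is a minimal *free resolution of `M` over the *local ring `(R, m)`: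
it is exact, the `F i` are *free, and every differential has image in `m F i`. -/
structure LeftSeq.IsMinimalFreeResolution {M : GrMod 𝒜} (F : LeftSeq M)
    (m : HomogeneousIdeal 𝒜) : Prop where
  free : ∀ i, (F.X i).IsStarFree
  surjective : Function.Surjective F.aug.toLin
  exact_zero : Function.Exact (F.d 0).toLin F.aug.toLin
  exact_succ : ∀ i, Function.Exact (F.d (i + 1)).toLin (F.d i).toLin
  minimal : ∀ i, LinearMap.range (F.d i).toLin ≤ m.toIdeal • (⊤ : Submodule R (F.X i))

/-- `0 → N → I 0 → I 1 → ⋯` is a minimal *injective resolution of `N`: it is exact, the `I i` are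
*injective, `I 0` is a *essential extension of the image of `N`, and `I (i+1)` is a *essential
extension of the image of `I i`. -/
structure RightSeq.IsMinimalInjectiveResolution {N : GrMod 𝒜} (I : RightSeq N) : Prop where
  starInjective : ∀ i, (I.X i).IsStarInjective
  injective : Function.Injective I.aug.toLin
  exact_zero : Function.Exact I.aug.toLin (I.d 0).toLin
  exact_succ : ∀ i, Function.Exact (I.d i).toLin (I.d (i + 1)).toLin
  essential_zero : (I.X 0).IsStarEssential (LinearMap.range I.aug.toLin)
  essential_succ : ∀ i, (I.X (i + 1)).IsStarEssential (LinearMap.range (I.d i).toLin)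

/-- The sequence obtained by applying `*Hom_R(-, E)` to `⋯ → F 1 → F 0 → M`. -/
noncomputable def LeftSeq.dual {M : GrMod 𝒜} (F : LeftSeq M) (E : GrMod 𝒜) :
    RightSeq (starHom M E) where
  X i := starHom (F.X i) E
  d i := starHomMap (F.d i) E
  aug := starHomMap F.aug E

/-- `c` is a value of the graded Betti number `β(i, M, a)`: in some minimal *free resolution `F` of
`M`, the number of summands `R(-a)` in a decomposition of `F i` as a direct sum of shifts of `R`
(equivalently, of elements of degree `a` in a homogeneous basis) is `c`. -/
def IsGradedBetti (m : HomogeneousIdeal 𝒜) (i : ℕ) (M : GrMod 𝒜) (a : ℤ) (c : Cardinal.{u}) :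
    Prop :=
  ∃ F : LeftSeq M, F.IsMinimalFreeResolution m ∧
    ∃ (J : Type u) (b : (F.X i).HomogeneousBasis J), c = Cardinal.mk {j : J // b.deg j = a}

/-- `c` is a value of the graded Bass number `*μ(i, p, z, N)`: in some minimal *injective resolution
`I` of `N`, the number of summands `*E_R((R/p)(-z))` in a decomposition of `I i` as a direct sum of
hulls `*E_R((R/𝔮)(-k))` is `c`. -/
def IsGradedBass (i : ℕ) (p : HomogeneousIdeal 𝒜) (z : ℤ) (N : GrMod 𝒜) (c : Cardinal.{u}) :
    Prop :=
  ∃ I : RightSeq N, I.IsMinimalInjectiveResolution ∧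
    ∃ (J : Type u) (D : (I.X i).HullDecomposition J),
      c = Cardinal.mk {j : J // (D.summand j).IsHullOf ((quot p).shift (-z))}

end GradedMatlis

open GradedMatlis

/-! Write `E` for the *injective hull of the residue field k = R/m. Since `E` is *injective,
`*Hom(-, E)` is exact, and `*Hom(F, E)` is *injective for *free `F`, because a graded map into it is
a family of homogeneous maps into `E` indexed by a basis. So the dual sequence is a *injective
resolution.

Minimality is a socle argument. Each F_i has finite rank, by Nakayama-type reasoning from `im ⊆ m
F_i`. Then a nonzero graded submodule of `*Hom(F_i, E)` contains a nonzero `f` killed by m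
(`HomogeneousBasis.exists_mem_socle`). Such an `f` vanishes on `m F_i`, hence on the image of
F_{i+1}, and exactness puts it in the image of the previous dual term.

For the numbers, a finite homogeneous basis of F_i with degrees d_j splits `*Hom(F_i, E)` into the
summands E(d_j). As k lives in degree 0 (`mem_of_mem_degree_ne_zero`), E(d) is a hull of k(-z) only
for d = -z, so every Betti number in degree -z is a Bass number in degree z. Bass numbers are
unique: minimal *injective resolutions are termwise isomorphic (`exists_bijective_of_essential`),
and the number of hulls of k(-z) in a decomposition is the k-dimension of the degree z part of the
socle (`HullDecomposition.exists_socle_parametrization`). Uniqueness of Betti numbers follows. -/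

namespace GradedMatlis

namespace GrMod

variable {R : Type u} [CommRing R] {𝒜 : ℤ → AddSubgroup R}

/-! ### Homogeneous components, graded maps and graded submodules -/

section Proj

variable (M : GrMod 𝒜)

theorem proj_mem (i : ℤ) (x : M) : M.proj i x ∈ M.gr i :=
  SetLike.coe_mem (DirectSum.decompose M.gr x i)

theorem homogeneous_induction {motive : M → Prop} (zero : motive 0)
    (add : ∀ x y, motive x → motive y → motive (x + y))
    (homogeneous : ∀ i, ∀ x ∈ M.gr i, motive x) (x : M) : motive x := by
  induction x using DirectSum.Decomposition.inductionOn M.gr with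
  | zero => exact zero
  | add x y hx hy => exact add x y hx hy
  | homogeneous x => exact homogeneous _ x x.2

theorem mem_of_proj_mem {S : Type*} [SetLike S M] [AddSubmonoidClass S M] (P : S) {x : M}
    (h : ∀ i, M.proj i x ∈ P) : x ∈ P := by
  classical
  rw [← DirectSum.sum_support_decompose M.gr x]
  exact sum_mem fun i _ => h i

theorem eq_zero_of_proj_eq_zero {x : M} (h : ∀ i, M.proj i x = 0) : x = 0 :=
  (AddSubgroup.mem_bot).1 (M.mem_of_proj_mem (⊥ : AddSubgroup M)
    fun i => AddSubgroup.mem_bot.2 (h i))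

theorem exists_proj_ne_zero {x : M} (h : x ≠ 0) : ∃ i, M.proj i x ≠ 0 := by
  by_contra! h'
  exact h (M.eq_zero_of_proj_eq_zero h')

theorem mem_gr_iff_proj {i : ℤ} {x : M} : x ∈ M.gr i ↔ M.proj i x = x :=
  ⟨M.proj_same, fun h => h ▸ M.proj_mem i x⟩

theorem eq_zero_of_mem_gr {i j : ℤ} {x : M} (hi : x ∈ M.gr i) (hj : x ∈ M.gr j) (h : i ≠ j) :
    x = 0 := by
  rw [← M.proj_same hj, M.proj_ne hi h]

theorem proj_smul_of_mem [GradedRing 𝒜] {j : ℤ} {x : M} (hx : x ∈ M.gr j) (i : ℤ) (r : R) :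
    M.proj i (r • x) = GradedRing.proj 𝒜 (i - j) r • x := by
  induction r using DirectSum.Decomposition.inductionOn 𝒜 with
  | zero => simp
  | add r s hr hs => rw [add_smul, map_add, map_add, add_smul, hr, hs]
  | @homogeneous l r =>
    by_cases h : l = i - j
    · subst h
      rw [GradedRing.proj_apply, DirectSum.decompose_of_mem_same 𝒜 r.2, M.proj_same]
      simpa using M.smul_mem r.2 hx
    · rw [GradedRing.proj_apply, DirectSum.decompose_of_mem_ne 𝒜 r.2 h, zero_smul]
      exact M.proj_ne (M.smul_mem r.2 hx) (by grind)

theorem shift_proj (n i : ℤ) (x : M) : (M.shift n).proj i x = M.proj (i + n) x := by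
  induction x using M.homogeneous_induction with
  | zero => exact ((M.shift n).proj i).map_zero.trans (M.proj (i + n)).map_zero.symm
  | add x y hx hy =>
    rw [map_add, ← hx, ← hy]
    exact ((M.shift n).proj i).map_add x y
  | homogeneous l x hx =>
    have hx' : x ∈ (M.shift n).gr (l - n) := by
      change x ∈ M.gr (l - n + n)
      simpa using hx
    by_cases h : l = i + n
    · subst h
      rw [M.proj_same hx]
      rw [add_sub_cancel_right] at hx'
      exact (M.shift n).proj_same hx'
    · rw [M.proj_ne hx h]
      exact (M.shift n).proj_ne hx' (by grind)

end Proj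

theorem Hom.map_proj {M N : GrMod 𝒜} (f : Hom M N) (i : ℤ) (x : M) :
    f.toLin (M.proj i x) = N.proj i (f.toLin x) := by
  induction x using M.homogeneous_induction with
  | zero => simp
  | add x y hx hy => simp only [map_add, hx, hy]
  | homogeneous l x hx =>
    by_cases h : l = i
    · subst h
      rw [M.proj_same hx, N.proj_same (f.map_mem _ x hx)]
    · rw [M.proj_ne hx h, N.proj_ne (f.map_mem _ x hx) h, map_zero]

theorem Hom.mem_gr_of_map_mem {M N : GrMod 𝒜} (f : Hom M N) (hf : Function.Injective f.toLin)
    {i : ℤ} {x : M} (h : f.toLin x ∈ N.gr i) : x ∈ M.gr i := by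
  rw [mem_gr_iff_proj] at h ⊢
  rw [← f.map_proj] at h
  exact hf h

/-- Composition of graded maps. -/
def Hom.comp {L M N : GrMod 𝒜} (g : Hom M N) (f : Hom L M) : Hom L N where
  toLin := g.toLin.comp f.toLin
  map_mem := fun i x hx => g.map_mem i _ (f.map_mem i x hx)

/-- The identity as a graded map. -/
def Hom.id (M : GrMod 𝒜) : Hom M M where
  toLin := LinearMap.id
  map_mem := fun _ _ hx => hx

theorem sub_isInternal (M : GrMod 𝒜) (P : Submodule R M) (hP : ∀ i, ∀ x ∈ P, M.proj i x ∈ P) :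
    DirectSum.IsInternal (fun i => (M.gr i).comap P.subtype.toAddMonoidHom) := by
  classical
  refine isInternal_of_separating (T := M) _ ?_ ?_
  · intro x
    have h : x = ∑ i ∈ DFinsupp.support (DirectSum.decompose M.gr (x : M)),
        (⟨M.proj i x, hP i x x.2⟩ : P) := by
      ext
      rw [AddSubmonoidClass.coe_finsetSum]
      exact (DirectSum.sum_support_decompose M.gr (x : M)).symm
    rw [h]
    exact sum_mem fun i _ => AddSubgroup.mem_iSup_of_mem i (M.proj_mem i x)
  · rintro i ⟨x, hxP⟩ hx hne
    refine ⟨(M.proj i).comp P.subtype.toAddMonoidHom, ?_, fun j hj y hy => M.proj_ne hy hj⟩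
    change M.proj i x ≠ 0
    have hx' : x ∈ M.gr i := hx
    rw [M.proj_same hx']
    exact fun h => hne (Subtype.ext h)

/-- A submodule stable under the projections, as a graded module. -/
noncomputable def sub (M : GrMod 𝒜) (P : Submodule R M) (hP : ∀ i, ∀ x ∈ P, M.proj i x ∈ P) :
    GrMod 𝒜 :=
  letI : DirectSum.Decomposition (fun i => (M.gr i).comap P.subtype.toAddMonoidHom) :=
    (sub_isInternal M P hP).chooseDecomposition
  haveI : SetLike.GradedSMul 𝒜 (fun i => (M.gr i).comap P.subtype.toAddMonoidHom) :=
    ⟨fun {_ _ _ _} hr hx => M.smul_mem hr hx⟩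
  { carrier := P
    gr := fun i => (M.gr i).comap P.subtype.toAddMonoidHom }

theorem range_proj_mem {M N : GrMod 𝒜} (f : Hom M N) (i : ℤ) (x : N)
    (hx : x ∈ LinearMap.range f.toLin) : N.proj i x ∈ LinearMap.range f.toLin := by
  obtain ⟨y, rfl⟩ := hx
  exact ⟨M.proj i y, f.map_proj i y⟩

theorem ker_proj_mem {M N : GrMod 𝒜} (f : Hom M N) (i : ℤ) (x : M)
    (hx : x ∈ LinearMap.ker f.toLin) : M.proj i x ∈ LinearMap.ker f.toLin := by
  rw [LinearMap.mem_ker] at hx ⊢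
  rw [f.map_proj, hx, map_zero]

theorem span_singleton_proj_mem [GradedRing 𝒜] {M : GrMod 𝒜} {j : ℤ} {x : M} (hx : x ∈ M.gr j)
    (i : ℤ) (y : M) (hy : y ∈ Submodule.span R {x}) : M.proj i y ∈ Submodule.span R {x} := by
  obtain ⟨r, rfl⟩ := Submodule.mem_span_singleton.1 hy
  rw [M.proj_smul_of_mem hx]
  exact Submodule.smul_mem _ _ (Submodule.mem_span_singleton_self x)

/-- To show exactness at the middle of a sequence of graded maps, homogeneous elements suffice. -/
theorem exact_of_homogeneous {L M N : GrMod 𝒜} (f : Hom L M) (g : Hom M N)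
    (hgf : ∀ x, g.toLin (f.toLin x) = 0)
    (h : ∀ i, ∀ x ∈ M.gr i, g.toLin x = 0 → x ∈ LinearMap.range f.toLin) :
    Function.Exact f.toLin g.toLin := by
  intro x
  constructor
  · intro hx
    refine M.mem_of_proj_mem (LinearMap.range f.toLin) fun i => ?_
    exact h i _ (M.proj_mem i x) (ker_proj_mem g i x hx)
  · rintro ⟨y, rfl⟩
    exact hgf y

/-! ### *Injective modules and exactness of the dual -/

section Injective

/-- The map `g` descends to the image of `f`, a graded submodule of `Q`, and extends from there to
`Q`. Thus `f` need not be injective. -/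
theorem IsStarInjective.exists_factor {E P Q : GrMod 𝒜} (hE : E.IsStarInjective)
    (f : Hom P Q) (g : Hom P E) (h : ∀ x, f.toLin x = 0 → g.toLin x = 0) :
    ∃ e : Hom Q E, ∀ x, e.toLin (f.toLin x) = g.toLin x := by
  let A := Q.sub (LinearMap.range f.toLin) (range_proj_mem f)
  let φ : LinearMap.range f.toLin →ₗ[R] E :=
    ((LinearMap.ker f.toLin).liftQ g.toLin h).comp f.toLin.quotKerEquivRange.symm.toLinearMap
  have hφ : ∀ x, φ ⟨f.toLin x, x, rfl⟩ = g.toLin x := by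
    intro x
    have : f.toLin.quotKerEquivRange.symm ⟨f.toLin x, x, rfl⟩ = Submodule.Quotient.mk x := by
      rw [LinearEquiv.symm_apply_eq]
      rfl
    change (LinearMap.ker f.toLin).liftQ g.toLin h (f.toLin.quotKerEquivRange.symm _) = _
    rw [this]
    exact (LinearMap.ker f.toLin).liftQ_apply g.toLin x
  let φ' : Hom A E :=
    { toLin := φ
      map_mem := by
        rintro i ⟨_, x, rfl⟩ hx
        have hx' : f.toLin x ∈ Q.gr i := hx
        -- A preimage of a homogeneous element may be replaced by its component of the same degree.
        have h1 : f.toLin x = f.toLin (P.proj i x) := by rw [f.map_proj, Q.proj_same hx']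
        have h2 : (⟨f.toLin x, x, rfl⟩ : LinearMap.range f.toLin) =
          ⟨f.toLin (P.proj i x), _, rfl⟩ := Subtype.ext h1
        change φ ⟨f.toLin x, x, rfl⟩ ∈ E.gr i
        rw [h2, hφ]
        exact g.map_mem i _ (P.proj_mem i x) }
  obtain ⟨e, he⟩ := hE A Q
    { toLin := (LinearMap.range f.toLin).subtype, map_mem := fun _ _ hx => hx } φ'
    Subtype.val_injective
  exact ⟨e, fun x => (he ⟨f.toLin x, x, rfl⟩).trans (hφ x)⟩

theorem IsStarInjective.shift {E : GrMod 𝒜} (hE : E.IsStarInjective) (n : ℤ) :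
    (E.shift n).IsStarInjective := by
  intro A B i f hi
  obtain ⟨g, hg⟩ := hE (A.shift (-n)) (B.shift (-n))
    { toLin := i.toLin, map_mem := fun l x hx => i.map_mem (l + -n) x hx }
    { toLin := f.toLin
      map_mem := fun l x hx => by
        have : f.toLin x ∈ E.gr (l + -n + n) := f.map_mem (l + -n) x hx
        rwa [neg_add_cancel_right] at this } hi
  refine ⟨{ toLin := g.toLin, map_mem := fun l x hx => ?_ }, hg⟩
  refine g.map_mem (l + n) x ?_
  change x ∈ B.gr (l + n + -n)
  rwa [add_neg_cancel_right]

theorem IsStarInjective.exists_factor_homDeg {E P Q : GrMod 𝒜} (hE : E.IsStarInjective)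
    (f : Hom P Q) {n : ℤ} {g : P →ₗ[R] E} (hg : g ∈ homDeg P E n)
    (h : ∀ x, f.toLin x = 0 → g x = 0) :
    ∃ e ∈ homDeg Q E n, e.comp f.toLin = g := by
  obtain ⟨e, he⟩ := (hE.shift n).exists_factor f { toLin := g, map_mem := hg } h
  exact ⟨e.toLin, e.map_mem, LinearMap.ext he⟩

variable [GradedRing 𝒜]

/-- A homogeneous map on `Q` that vanishes on `im f = ker g` factors through `g` with the same
degree; homogeneous maps suffice because kernels and images are graded. -/
theorem starHomMap_exact {E : GrMod 𝒜} (hE : E.IsStarInjective) {P Q S : GrMod 𝒜}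
    (f : Hom P Q) (g : Hom Q S) (h : Function.Exact f.toLin g.toLin) :
    Function.Exact (starHomMap g E).toLin (starHomMap f E).toLin := by
  refine exact_of_homogeneous _ _ ?_ ?_
  · rintro ⟨e, he⟩
    refine Subtype.ext (LinearMap.ext fun x => ?_)
    change e (g.toLin (f.toLin x)) = 0
    rw [h.apply_apply_eq_zero, map_zero]
  · rintro n ⟨e, he⟩ hen h0
    have h0' : ∀ x, e (f.toLin x) = 0 := fun x => LinearMap.congr_fun (congrArg Subtype.val h0) x
    obtain ⟨e', he', hee⟩ := hE.exists_factor_homDeg g (n := n) (g := e) hen (fun x hx => by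
      obtain ⟨y, rfl⟩ := (h x).1 hx
      exact h0' y)
    exact ⟨⟨e', mem_starHomSubmodule_of_homDeg _ _ he'⟩, Subtype.ext hee⟩

theorem starHomMap_injective (E : GrMod 𝒜) {P Q : GrMod 𝒜} (f : Hom P Q)
    (h : Function.Surjective f.toLin) : Function.Injective (starHomMap f E).toLin := by
  rintro ⟨a, ha⟩ ⟨b, hb⟩ hab
  refine Subtype.ext (LinearMap.ext fun x => ?_)
  obtain ⟨y, rfl⟩ := h x
  exact LinearMap.congr_fun (congrArg Subtype.val hab) y

end Injective

/-! ### Homogeneous bases -/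

section Basis

variable [GradedRing 𝒜] {F : GrMod 𝒜} {J : Type u} (b : F.HomogeneousBasis J)

theorem HomogeneousBasis.repr_proj (i : ℤ) (x : F) (j : J) :
    b.basis.repr (F.proj i x) j = GradedRing.proj 𝒜 (i - b.deg j) (b.basis.repr x j) := by
  classical
  obtain ⟨c, rfl⟩ := b.basis.repr.symm.surjective x
  induction c using Finsupp.induction_linear with
  | zero => simp
  | add c d hc hd => simp only [map_add, Finsupp.add_apply, hc, hd]
  | single l r =>
    rw [b.basis.repr_symm_single, F.proj_smul_of_mem (b.mem l)]
    by_cases h : l = j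
    · subst h
      simp
    · simp [h]

end Basis

end GrMod
end GradedMatlis

namespace GradedMatlis

namespace GrMod

variable {R : Type u} [CommRing R] {𝒜 : ℤ → AddSubgroup R} [GradedRing 𝒜]

/-- An element of `*Hom_R(M, N)` as a linear map. -/
def starHomCoe (M N : GrMod 𝒜) : starHom M N →ₗ[R] M →ₗ[R] N where
  toFun f := Subtype.val (p := (· ∈ starHomSubmodule M N)) f
  map_add' := fun _ _ => rfl
  map_smul' := fun _ _ => rfl

theorem starHomCoe_injective (M N : GrMod 𝒜) : Function.Injective (starHomCoe M N) :=
  Subtype.val_injective (p := (· ∈ starHomSubmodule M N))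

section Basis

variable {F : GrMod 𝒜} {J : Type u} (b : F.HomogeneousBasis J)

theorem HomogeneousBasis.repr_mem {l : ℤ} {x : F} (hx : x ∈ F.gr l) (j : J) :
    b.basis.repr x j ∈ 𝒜 (l - b.deg j) := by
  rw [← F.proj_same hx, b.repr_proj]
  exact SetLike.coe_mem _

theorem HomogeneousBasis.constr_mem_homDeg {E : GrMod 𝒜} {n : ℤ} {y : J → E}
    (hy : ∀ j, y j ∈ E.gr (b.deg j + n)) : b.basis.constr R y ∈ homDeg F E n := by
  intro l x hx
  rw [Module.Basis.constr_apply]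
  refine sum_mem fun j _ => ?_
  have := E.smul_mem (b.repr_mem hx j) (hy j)
  rwa [show l - b.deg j + (b.deg j + n) = l + n by ring] at this

theorem HomogeneousBasis.smulRight_mem_homDeg {E : GrMod 𝒜} {n : ℤ} {j : J} {y : E}
    (hy : y ∈ E.gr (n + b.deg j)) : (b.basis.coord j).smulRight y ∈ homDeg F E n := by
  intro l x hx
  have := E.smul_mem (b.repr_mem hx j) hy
  rwa [show l - b.deg j + (n + b.deg j) = l + n by ring] at this

theorem IsStarInjective.starHom {E : GrMod 𝒜} (hE : E.IsStarInjective) (hF : F.IsStarFree) :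
    (F.starHom E).IsStarInjective := by
  obtain ⟨J, ⟨b⟩⟩ := hF
  intro A B i f hi
  -- Evaluation at the `j`-th basis element turns a graded map into `*Hom(F, E)` into a map into `E`
  -- of degree `b.deg j`, which extends to `B`; the extensions are then reassembled.
  have key : ∀ j, ∃ e ∈ homDeg B E (b.deg j),
      e.comp i.toLin = (LinearMap.applyₗ (b.basis j)).comp ((starHomCoe F E).comp f.toLin) := by
    intro j
    refine hE.exists_factor_homDeg i ?_ ?_
    · intro l a ha
      have := f.map_mem l a ha (b.deg j) (b.basis j) (b.mem j)
      rwa [add_comm] at this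
    · intro a ha
      rw [(injective_iff_map_eq_zero i.toLin).1 hi a ha, map_zero]
  choose e he hei using key
  let G : B →ₗ[R] F →ₗ[R] E := (b.basis.constr R).toLinearMap.comp (LinearMap.pi e)
  have hG : ∀ l, ∀ x ∈ B.gr l, G x ∈ homDeg F E l := fun l x hx =>
    b.constr_mem_homDeg fun j => by
      rw [add_comm]
      exact he j l x hx
  have hG' : ∀ x, G x ∈ starHomSubmodule F E := fun x => by
    induction x using B.homogeneous_induction with
    | zero => rw [map_zero]; exact zero_mem _
    | add x y hx hy => rw [map_add]; exact add_mem hx hy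
    | homogeneous l x hx => exact mem_starHomSubmodule_of_homDeg F E (hG l x hx)
  refine ⟨{ toLin := LinearMap.codRestrict (starHomSubmodule F E) G hG', map_mem := hG }, ?_⟩
  intro a
  apply starHomCoe_injective
  refine b.basis.ext fun j => ?_
  change G (i.toLin a) (b.basis j) = _
  simp only [G, LinearMap.comp_apply, LinearEquiv.coe_coe, Module.Basis.constr_basis,
    LinearMap.pi_apply]
  exact LinearMap.congr_fun (hei j) a

end Basis

/-! ### Finite generation -/

section Finite

/-- A maximal finitely generated graded submodule must be everything: adjoining a homogeneous
element keeps it finitely generated and graded. -/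
theorem IsStarNoetherian.finite {M : GrMod 𝒜} (hM : M.IsStarNoetherian) : Module.Finite R M := by
  have hwf : WellFoundedGT (HomogeneousSubmodule 𝒜 M.gr) :=
    wellFoundedGT_iff_monotone_chain_condition.2 hM
  obtain ⟨U, hU, hmax⟩ := hwf.wf.has_min {U | U.toSubmodule.FG}
    ⟨⟨⊥, fun i x hx => by
      rw [(Submodule.mem_bot R).1 hx]
      exact (M.proj i).map_zero⟩, Submodule.fg_bot⟩
  have htop : ∀ x : M, x ∈ U.toSubmodule := by
    intro x
    induction x using M.homogeneous_induction with
    | zero => exact zero_mem _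
    | add x y hx hy => exact add_mem hx hy
    | homogeneous j x hx =>
      by_contra hxU
      let V : HomogeneousSubmodule 𝒜 M.gr :=
        ⟨U.toSubmodule ⊔ Submodule.span R {x}, fun i y hy => by
          obtain ⟨u, hu, v, hv, rfl⟩ := Submodule.mem_sup.1 hy
          change M.proj i (u + v) ∈ _
          rw [map_add]
          exact Submodule.add_mem_sup (U.isHomogeneous i hu)
            (span_singleton_proj_mem hx i v hv)⟩
      refine hmax V (hU.sup (Submodule.fg_span_singleton x)) (lt_of_le_of_ne ?_ ?_)
      · exact fun y hy => Submodule.mem_sup_left hy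
      · intro h
        apply hxU
        rw [h]
        exact Submodule.mem_sup_right (Submodule.mem_span_singleton_self x)
  exact ⟨(eq_top_iff.2 fun x _ => htop x : U.toSubmodule = ⊤) ▸ hU⟩

/-- Finitely many elements of `F` already generate the image and involve only finitely many
coordinates. For any other `j`, `b j` differs from a combination of them by a kernel element with
`j`-th coordinate 1, which would force 1 into `I`. -/
theorem _root_.Module.Basis.finite_of_ker_le_smul {R F N J : Type*} [CommRing R] [AddCommGroup F]
    [Module R F] [AddCommGroup N] [Module R N] (b : Module.Basis J R F) (g : F →ₗ[R] N)
    (hg : (LinearMap.range g).FG) {I : Ideal R} (hI : I ≠ ⊤)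
    (hker : LinearMap.ker g ≤ I • (⊤ : Submodule R F)) : Finite J := by
  classical
  obtain ⟨S, hS⟩ := hg
  obtain ⟨T, -, rfl⟩ := (Finset.subset_set_image_iff (s := Set.univ) (t := S) (f := g)).1
    (by rw [Set.image_univ, ← LinearMap.coe_range, ← hS]; exact Submodule.subset_span)
  by_contra hJ
  rw [not_finite_iff_infinite] at hJ
  obtain ⟨j, hj⟩ := Infinite.exists_notMem_finset (T.biUnion fun t => (b.repr t).support)
  have hT : Submodule.span R (T : Set F) ≤ LinearMap.ker (b.coord j) := by
    rw [Submodule.span_le]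
    intro t ht
    simp only [Finset.mem_biUnion, not_exists, not_and] at hj
    simpa using hj t ht
  have hmap : ∀ x ∈ I • (⊤ : Submodule R F), b.coord j x ∈ I := by
    intro x hx
    induction hx using Submodule.smul_induction_on' with
    | smul r hr n hn => rw [map_smul]; exact I.mul_mem_right _ hr
    | add x _ y _ hx hy => rw [map_add]; exact add_mem hx hy
  have h1 : g (b j) ∈ (Submodule.span R (T : Set F)).map g := by
    rw [Submodule.map_span, ← Finset.coe_image, hS]
    exact ⟨_, rfl⟩
  obtain ⟨p, hp, hpj⟩ := h1
  have h2 : b.coord j (b j - p) ∈ I := hmap _ (hker (by simp [hpj]))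
  rw [map_sub, hT hp, sub_zero, Module.Basis.coord_apply, Module.Basis.repr_self,
    Finsupp.single_eq_same] at h2
  exact hI ((Ideal.eq_top_iff_one I).2 h2)

end Finite

/-! ### Socles and essentiality of the dual sequence -/

section Essential

variable {m : HomogeneousIdeal 𝒜} {E : GrMod 𝒜}

theorem quot_smul_eq_zero {x : quot m} {s : R} (hs : s ∈ m.toIdeal) : s • x = 0 := by
  obtain ⟨r, rfl⟩ := Ideal.Quotient.mk_surjective x
  exact Ideal.Quotient.eq_zero_iff_mem.2 (m.toIdeal.mul_mem_right r hs)

theorem IsHullOf.exists_smul_socle (hE : E.IsHullOf (quot m)) {i : ℤ} {x : E} (hx : x ∈ E.gr i)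
    (hx0 : x ≠ 0) :
    ∃ l, ∃ r ∈ 𝒜 l, r • x ≠ 0 ∧ ∀ s ∈ m.toIdeal, s • r • x = 0 := by
  obtain ⟨φ, hφ⟩ := hE
  have hne := hφ.essential ⟨Submodule.span R {x}, fun i y hy => span_singleton_proj_mem hx i y hy⟩
    (by simpa using hx0)
  obtain ⟨y, hy, hy0⟩ := Submodule.exists_mem_ne_zero_of_ne_bot hne
  obtain ⟨hyx, hyφ⟩ := Submodule.mem_inf.1 hy
  obtain ⟨r, rfl⟩ := Submodule.mem_span_singleton.1 hyx
  -- The multiplier is made homogeneous by passing to a nonzero component, which stays in the image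
  -- of `R/m`.
  obtain ⟨n, hn⟩ := E.exists_proj_ne_zero hy0
  obtain ⟨w, hw⟩ := range_proj_mem φ n _ hyφ
  rw [E.proj_smul_of_mem hx] at hn hw
  refine ⟨n - i, _, SetLike.coe_mem _, hn, fun s hs => ?_⟩
  refine (congrArg (s • ·) hw.symm).trans ?_
  rw [← map_smul, quot_smul_eq_zero hs, map_zero]

variable {F : GrMod 𝒜} {J : Type u}

/-- Basis elements are treated one at a time: a homogeneous multiplier moves the value of `f` there
into the socle of `E` without killing it. Values already in the socle remain there, and finiteness
of `J` ends the process. -/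
theorem HomogeneousBasis.exists_mem_socle (b : F.HomogeneousBasis J) [Finite J]
    (hE : E.IsHullOf (quot m)) (U : HomogeneousSubmodule 𝒜 (F.starHom E).gr)
    (hU : U.toSubmodule ≠ ⊥) :
    ∃ f ∈ U.toSubmodule, f ≠ 0 ∧ ∀ s ∈ m.toIdeal, s • f = 0 := by
  classical
  have := Fintype.ofFinite J
  have key : ∀ T : Finset J, ∃ n, ∃ f ∈ U.toSubmodule, f ∈ (F.starHom E).gr n ∧ f ≠ 0 ∧
      ∀ j ∈ T, ∀ s ∈ m.toIdeal, s • starHomCoe F E f (b.basis j) = 0 := by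
    intro T
    induction T using Finset.induction_on with
    | empty =>
      obtain ⟨f, hf, hf0⟩ := Submodule.exists_mem_ne_zero_of_ne_bot hU
      obtain ⟨n, hn⟩ := (F.starHom E).exists_proj_ne_zero hf0
      exact ⟨n, _, U.isHomogeneous n hf, (F.starHom E).proj_mem n f, hn, by simp⟩
    | insert j T _ ih =>
      obtain ⟨n, f, hf, hfn, hf0, hT⟩ := ih
      by_cases hj : starHomCoe F E f (b.basis j) = 0
      · refine ⟨n, f, hf, hfn, hf0, fun j' hj' => ?_⟩
        rcases Finset.mem_insert.1 hj' with rfl | hj'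
        · simp [hj]
        · exact hT j' hj'
      · have hfj : starHomCoe F E f (b.basis j) ∈ E.gr (b.deg j + n) := hfn _ _ (b.mem j)
        obtain ⟨l, r, hr, hr0, hrm⟩ := hE.exists_smul_socle hfj hj
        refine ⟨l + n, r • f, Submodule.smul_mem _ r hf, (F.starHom E).smul_mem hr hfn, ?_, ?_⟩
        · intro h
          apply hr0
          rw [← LinearMap.smul_apply, ← map_smul, h, map_zero, LinearMap.zero_apply]
        · intro j' hj' s hs
          rw [map_smul, LinearMap.smul_apply]
          rcases Finset.mem_insert.1 hj' with rfl | hj'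
          · exact hrm s hs
          · rw [smul_comm, hT j' hj' s hs, smul_zero]
  obtain ⟨n, f, hf, -, hf0, h⟩ := key Finset.univ
  refine ⟨f, hf, hf0, fun s hs => ?_⟩
  apply starHomCoe_injective
  refine b.basis.ext fun j => ?_
  rw [map_smul, LinearMap.smul_apply, h j (Finset.mem_univ j) s hs, map_zero, LinearMap.zero_apply]

/-- A socle element of `*Hom(F, E)` kills `m F`, hence `im f`, so by exactness of the dual it comes
from `S`. -/
theorem HomogeneousBasis.starHom_isStarEssential (b : F.HomogeneousBasis J) [Finite J]
    (hE : E.IsHullOf (quot m)) {P S : GrMod 𝒜} (f : Hom P F) (g : Hom F S)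
    (h : Function.Exact f.toLin g.toLin)
    (hf : LinearMap.range f.toLin ≤ m.toIdeal • (⊤ : Submodule R F)) :
    (F.starHom E).IsStarEssential (LinearMap.range (starHomMap g E).toLin) := by
  intro U hU
  obtain ⟨e, heU, he0, hem⟩ := b.exists_mem_socle hE U hU
  have hk : m.toIdeal • (⊤ : Submodule R F) ≤ LinearMap.ker (starHomCoe F E e) := by
    rw [Submodule.smul_le]
    intro r hr x _
    rw [LinearMap.mem_ker, map_smul, ← LinearMap.smul_apply, ← map_smul, hem r hr, map_zero,
      LinearMap.zero_apply]
  have hinj : E.IsStarInjective := hE.choose_spec.starInjective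
  have : e ∈ LinearMap.range (starHomMap g E).toLin := by
    refine (starHomMap_exact hinj f g h e).1 ?_
    apply starHomCoe_injective
    exact LinearMap.ext fun x => hk (hf ⟨x, rfl⟩)
  exact (Submodule.ne_bot_iff _).2 ⟨e, ⟨heU, this⟩, he0⟩

end Essential

/-! ### Splitting the dual of a *free module into hulls -/

section HullDecomposition

variable {m : HomogeneousIdeal 𝒜} {E : GrMod 𝒜}

theorem IsHullOf.shift {H M : GrMod 𝒜} (h : H.IsHullOf M) (n : ℤ) :
    (H.shift n).IsHullOf (M.shift n) := by
  obtain ⟨φ, hφ⟩ := h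
  refine ⟨{ toLin := φ.toLin, map_mem := fun i x hx => φ.map_mem (i + n) x hx },
    hφ.injective, hφ.starInjective.shift n, ?_⟩
  intro U hU
  refine hφ.essential ⟨U.toSubmodule, fun i x hx => ?_⟩ hU
  have := U.isHomogeneous (i - n) hx
  change (H.shift n).proj (i - n) x ∈ U.toSubmodule at this
  rwa [shift_proj, sub_add_cancel] at this

variable {F : GrMod 𝒜} {J : Type u} (b : F.HomogeneousBasis J)

/-- The map sending `y` to the linear map `x ↦ x_j y`, with `x_j` the `j`-th coordinate of `x`. -/
noncomputable def HomogeneousBasis.coordSMul (E : GrMod 𝒜) (j : J) : E →ₗ[R] F →ₗ[R] E where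
  toFun y := (b.basis.coord j).smulRight y
  map_add' := fun _ _ => LinearMap.ext fun _ => smul_add _ _ _
  map_smul' := fun _ _ => LinearMap.ext fun _ => smul_comm _ _ _

theorem HomogeneousBasis.coordSMul_mem (E : GrMod 𝒜) (j : J) (y : E) :
    b.coordSMul E j y ∈ starHomSubmodule F E := by
  induction y using E.homogeneous_induction with
  | zero => rw [map_zero]; exact zero_mem _
  | add x y hx hy => rw [map_add]; exact add_mem hx hy
  | homogeneous l y hy =>
    refine mem_starHomSubmodule_of_homDeg F E (n := l - b.deg j) (b.smulRight_mem_homDeg ?_)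
    rwa [sub_add_cancel]

/-- The inclusion of the summand of `*Hom_R(F, E)` given by a member of a homogeneous basis. -/
noncomputable def HomogeneousBasis.starHomIncl (E : GrMod 𝒜) (j : J) :
    Hom (E.shift (b.deg j)) (F.starHom E) where
  toLin := LinearMap.codRestrict (starHomSubmodule F E) (b.coordSMul E j) (b.coordSMul_mem E j)
  map_mem := fun _ _ hy => b.smulRight_mem_homDeg hy

theorem HomogeneousBasis.starHomIncl_apply (E : GrMod 𝒜) (j : J) (y : E) (x : F) :
    starHomCoe F E ((b.starHomIncl E j).toLin y) x = b.basis.repr x j • y := rfl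

theorem HomogeneousBasis.toModule_starHomIncl_apply [DecidableEq J] (E : GrMod 𝒜)
    (x : DirectSum J fun j => E.shift (b.deg j)) (j : J) :
    starHomCoe F E (DirectSum.toModule R J (F.starHom E) (fun j => (b.starHomIncl E j).toLin) x)
      (b.basis j) = x j := by
  induction x using DirectSum.induction_on with
  | zero => rfl
  | add x y hx hy =>
    rw [map_add, map_add, LinearMap.add_apply, hx, hy]
    rfl
  | of i y =>
    rw [← DirectSum.lof_eq_of R, DirectSum.toModule_lof]
    refine (b.starHomIncl_apply E i y (b.basis j)).trans ?_
    by_cases h : i = j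
    · subst h
      rw [DirectSum.lof_apply, Module.Basis.repr_self, Finsupp.single_eq_same]
      exact one_smul R _
    · rw [DirectSum.lof_eq_of, DirectSum.of_eq_of_ne _ _ _ (Ne.symm h), Module.Basis.repr_self,
        Finsupp.single_eq_of_ne h]
      exact zero_smul R _

theorem HomogeneousBasis.bijective_toModule_starHomIncl [DecidableEq J] [Finite J]
    (E : GrMod 𝒜) : Function.Bijective
      (DirectSum.toModule R J (F.starHom E) (fun j => (b.starHomIncl E j).toLin)) := by
  constructor
  · rw [injective_iff_map_eq_zero]
    intro x hx
    refine DFinsupp.ext fun j => ?_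
    rw [← b.toModule_starHomIncl_apply E x j, hx, map_zero]
    rfl
  · intro f
    have := Fintype.ofFinite J
    let y : ∀ j, E.shift (b.deg j) := fun j => starHomCoe F E f (b.basis j)
    -- Since `J` is finite, the family of values on the basis is an element of the direct sum.
    refine ⟨DFinsupp.equivFunOnFintype.symm y, ?_⟩
    apply starHomCoe_injective
    refine b.basis.ext fun j => ?_
    rw [b.toModule_starHomIncl_apply]
    rfl

/-- The decomposition of `*Hom_R(F, E)` given by a finite homogeneous basis of `F`. -/
noncomputable def HomogeneousBasis.hullDecomposition [Finite J] (hm : m.toIdeal.IsPrime)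
    (hE : E.IsHullOf (quot m)) : (F.starHom E).HullDecomposition J where
  summand j := E.shift (b.deg j)
  incl j := b.starHomIncl E j
  isHull j := ⟨m, -b.deg j, hm, by rw [neg_neg]; exact hE.shift _⟩
  bijective := letI := Classical.decEq J; b.bijective_toModule_starHomIncl E

end HullDecomposition

end GrMod
end GradedMatlis

namespace GradedMatlis

open GrMod

variable {R : Type u} [CommRing R] {𝒜 : ℤ → AddSubgroup R} [GradedRing 𝒜]
  {m : HomogeneousIdeal 𝒜}

namespace GrMod

/-! ### The residue field sits in degree zero -/

section ResidueField

/-- If the residue ring of a graded ideal is a field, then it is concentrated in degree zero. -/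
theorem mem_of_mem_degree_ne_zero (hk : IsField (R ⧸ m.toIdeal)) {n : ℤ} (hn : n ≠ 0) {r : R}
    (hr : r ∈ 𝒜 n) : r ∈ m.toIdeal := by
  classical
  have hmax : m.toIdeal.IsMaximal := Ideal.Quotient.maximal_of_isField _ hk
  have hprime := hmax.isPrime
  by_contra hrm
  have hone : ∀ i : ℤ, i ≠ 0 → (DirectSum.decompose 𝒜 (1 : R) i : R) = 0 := fun i hi =>
    DirectSum.decompose_of_mem_ne 𝒜 SetLike.GradedOne.one_mem hi.symm
  have hone' : (DirectSum.decompose 𝒜 (1 : R) 0 : R) = 1 :=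
    DirectSum.decompose_of_mem_same 𝒜 SetLike.GradedOne.one_mem
  -- If `r ∉ m`, the inhomogeneous element `1 + r` is a unit modulo m, its degree 0 component being
  -- 1. The components of an inverse `s` then satisfy a recursion incompatible with finite support.
  have h1r : 1 + r ∉ m.toIdeal := by
    intro h
    have := m.isHomogeneous 0 h
    rw [DirectSum.decompose_add, DirectSum.add_apply, AddMemClass.coe_add, hone',
      DirectSum.decompose_of_mem_ne 𝒜 hr hn, add_zero] at this
    exact hprime.ne_top ((Ideal.eq_top_iff_one _).2 this)
  obtain ⟨s, t, ht, hs⟩ := hmax.exists_inv h1r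
  have hst : s * 1 + s * r - 1 ∈ m.toIdeal := by
    have : s * 1 + s * r - 1 = -t := by linear_combination hs
    rw [this]
    exact neg_mem ht
  have hrel : ∀ i : ℤ, (DirectSum.decompose 𝒜 s (i + n) : R) + (DirectSum.decompose 𝒜 s i : R) * r
      - (DirectSum.decompose 𝒜 (1 : R) (i + n) : R) ∈ m.toIdeal := by
    intro i
    have := m.isHomogeneous (i + n) hst
    rwa [DirectSum.decompose_sub, DirectSum.sub_apply, AddSubgroupClass.coe_sub,
      DirectSum.decompose_add, DirectSum.add_apply, AddMemClass.coe_add, mul_one,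
      DirectSum.coe_decompose_mul_add_of_right_mem 𝒜 hr] at this
  have hiff : ∀ i : ℤ, i + n ≠ 0 → ((DirectSum.decompose 𝒜 s (i + n) : R) ∈ m.toIdeal ↔
      (DirectSum.decompose 𝒜 s i : R) ∈ m.toIdeal) := by
    intro i hi
    have := hrel i
    rw [hone _ hi, sub_zero] at this
    constructor
    · intro h
      exact (hprime.mem_or_mem ((Ideal.add_mem_iff_right _ h).1 this)).resolve_right hrm
    · intro h
      exact (Ideal.add_mem_iff_left _ (Ideal.mul_mem_right r _ h)).1 this
  obtain ⟨N, hN⟩ : ∃ N : ℕ, ∀ i : ℤ, N ≤ i.natAbs → (DirectSum.decompose 𝒜 s i : R) = 0 := by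
    refine ⟨(DFinsupp.support (DirectSum.decompose 𝒜 s)).sup Int.natAbs + 1, fun i hi => ?_⟩
    by_contra h
    have hi' : i ∈ DFinsupp.support (DirectSum.decompose 𝒜 s) := by
      rw [DFinsupp.mem_support_iff]
      exact fun h' => h (by rw [h']; rfl)
    have := Finset.le_sup (f := Int.natAbs) hi'
    omega
  have hlarge : ∀ k : ℕ, N ≤ k → (DirectSum.decompose 𝒜 s (n * k) : R) ∈ m.toIdeal ∧
      (DirectSum.decompose 𝒜 s (n * -k) : R) ∈ m.toIdeal := by
    intro k hk
    have hn' : 1 ≤ n.natAbs := by omega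
    have : N ≤ n.natAbs * k := le_trans hk (Nat.le_mul_of_pos_left k hn')
    constructor
    · rw [hN _ (by simpa [Int.natAbs_mul] using this)]
      exact zero_mem _
    · rw [hN _ (by simpa [Int.natAbs_mul] using this)]
      exact zero_mem _
  -- Components of `s` far out on either side vanish, and membership in m propagates inwards to
  -- `s_0` on one side and to `s_{-n}` on the other. The recursion breaks only between these two,
  -- where the component of 1 enters.
  have hA : ∀ k : ℕ, (DirectSum.decompose 𝒜 s (n * k) : R) ∈ m.toIdeal →
      (DirectSum.decompose 𝒜 s 0 : R) ∈ m.toIdeal := by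
    intro k
    induction k with
    | zero =>
      rw [show n * ((0 : ℕ) : ℤ) = 0 by simp]
      exact id
    | succ k ih =>
      intro h
      have e : n * ((k + 1 : ℕ) : ℤ) = n * k + n := by push_cast; ring
      rw [e] at h
      refine ih ((hiff _ ?_).1 h)
      rw [← e]
      exact mul_ne_zero hn (by positivity)
  have hB : ∀ k : ℕ, (DirectSum.decompose 𝒜 s (n * -(k + 1 : ℕ)) : R) ∈ m.toIdeal →
      (DirectSum.decompose 𝒜 s (-n) : R) ∈ m.toIdeal := by
    intro k
    induction k with
    | zero =>
      rw [show n * -((0 + 1 : ℕ) : ℤ) = -n by simp]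
      exact id
    | succ k ih =>
      intro h
      have e : n * -((k + 1 : ℕ) : ℤ) = n * -((k + 1 + 1 : ℕ) : ℤ) + n := by push_cast; ring
      refine ih ?_
      rw [e]
      refine (hiff _ ?_).2 h
      rw [← e]
      exact mul_ne_zero hn (neg_ne_zero.2 (by positivity))
  -- The remaining relation `s_0 + s_{-n} r - 1 ∈ m` now yields `1 ∈ m`.
  have h0 := hrel (-n)
  rw [neg_add_cancel, hone'] at h0
  have h1 := sub_mem (add_mem (hA _ (hlarge N le_rfl).1)
    (Ideal.mul_mem_right r _ (hB N (hlarge (N + 1) (by omega)).2))) h0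
  rw [sub_sub_cancel] at h1
  exact hprime.ne_top ((Ideal.eq_top_iff_one _).2 h1)

theorem quot_mem_gr_zero (hk : IsField (R ⧸ m.toIdeal)) (x : quot m) : x ∈ (quot m).gr 0 := by
  induction x using (quot m).homogeneous_induction with
  | zero => exact zero_mem _
  | add x y hx hy => exact add_mem hx hy
  | homogeneous i x hx =>
    by_cases hi : i = 0
    · exact hi ▸ hx
    · obtain ⟨r, hr, rfl⟩ := hx
      have : (Ideal.Quotient.mk m.toIdeal).toAddMonoidHom r = 0 :=
        Ideal.Quotient.eq_zero_iff_mem.2 (mem_of_mem_degree_ne_zero hk hi hr)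
      rw [this]
      exact zero_mem _

/-- The part of degree `z` of the socle of a hull of `(R/𝔮)(-k)`. -/
theorem IsStarInjectiveHull.socle (hk : IsField (R ⧸ m.toIdeal)) {q : HomogeneousIdeal 𝒜}
    (hq : q.toIdeal.IsPrime) {k : ℤ} {H : GrMod 𝒜} {φ : Hom ((quot q).shift (-k)) H}
    (hφ : IsStarInjectiveHull φ) {z : ℤ} {x : H} (hx : x ∈ H.gr z) (hx0 : x ≠ 0)
    (hxm : ∀ s ∈ m.toIdeal, s • x = 0) :
    q = m ∧ k = z ∧ x ∈ LinearMap.range φ.toLin := by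
  have hmax : m.toIdeal.IsMaximal := Ideal.Quotient.maximal_of_isField _ hk
  have hxφ : x ∈ LinearMap.range φ.toLin := by
    have hne := hφ.essential
      ⟨Submodule.span R {x}, fun i y hy => span_singleton_proj_mem hx i y hy⟩ (by simpa using hx0)
    obtain ⟨y, hy, hy0⟩ := Submodule.exists_mem_ne_zero_of_ne_bot hne
    obtain ⟨hyx, hyφ⟩ := Submodule.mem_inf.1 hy
    obtain ⟨r, rfl⟩ := Submodule.mem_span_singleton.1 hyx
    -- As m kills `x`, `r` acts on `x` invertibly, so `x` itself lies in the image once `r • x`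
    -- does.
    obtain ⟨s, t, ht, hs⟩ := hmax.exists_inv (x := r) fun hr => hy0 (hxm r hr)
    have : x = s • r • x := by
      have h1 := congrArg (· • x) hs
      simpa [add_smul, mul_smul, hxm t ht] using h1.symm
    rw [this]
    exact Submodule.smul_mem _ s hyφ
  obtain ⟨y, rfl⟩ := hxφ
  have hy0 : y ≠ 0 := fun h => hx0 (by rw [h, map_zero])
  have hy : y ∈ ((quot q).shift (-k)).gr z := φ.mem_gr_of_map_mem hφ.injective hx
  have hym : ∀ s ∈ m.toIdeal, s • y = 0 := fun s hs =>
    hφ.injective (by rw [map_smul, hxm s hs, map_zero])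
  have hqm : q = m := by
    obtain ⟨a, ha⟩ := Ideal.Quotient.mk_surjective (I := q.toIdeal) y
    have haq : a ∉ q.toIdeal := fun h => hy0 (ha.symm.trans (Ideal.Quotient.eq_zero_iff_mem.2 h))
    have hle : m.toIdeal ≤ q.toIdeal := by
      intro s hs
      have h1 : Ideal.Quotient.mk q.toIdeal (s * a) = 0 := by
        have := hym s hs
        rw [← ha] at this
        exact this
      exact (hq.mem_or_mem (Ideal.Quotient.eq_zero_iff_mem.1 h1)).resolve_right haq
    exact (HomogeneousIdeal.toIdeal_injective (hmax.eq_of_le hq.ne_top hle)).symm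
  refine ⟨hqm, ?_, ⟨y, rfl⟩⟩
  subst hqm
  by_contra hkz
  refine hy0 ((quot q).eq_zero_of_mem_gr (quot_mem_gr_zero hk y) hy ?_)
  omega

theorem shift_isHullOf_iff (hk : IsField (R ⧸ m.toIdeal)) {E : GrMod 𝒜}
    (hE : E.IsHullOf (quot m)) (d z : ℤ) :
    (E.shift d).IsHullOf ((quot m).shift (-z)) ↔ d = -z := by
  constructor
  · rintro ⟨φ, hφ⟩
    have hprime := (Ideal.Quotient.maximal_of_isField _ hk).isPrime
    have h' : (E.shift d).IsHullOf ((quot m).shift (- -d)) := by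
      rw [neg_neg]
      exact hE.shift d
    obtain ⟨φ', hφ'⟩ := h'
    have h1 : (1 : R ⧸ m.toIdeal) ≠ 0 := fun h =>
      hprime.ne_top ((Ideal.eq_top_iff_one _).2 (Ideal.Quotient.eq_zero_iff_mem.1 h))
    let u : (quot m).shift (-z) := (1 : R ⧸ m.toIdeal)
    have hu : u ∈ ((quot m).shift (-z)).gr z := by
      change u ∈ (quot m).gr (z + -z)
      rw [add_neg_cancel]
      exact quot_mem_gr_zero hk u
    have := (hφ'.socle hk hprime (φ.map_mem z u hu)
      (fun h => h1 (hφ.injective (h.trans (map_zero _).symm)))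
      (fun s hs => by
        rw [← map_smul]
        exact (congrArg φ.toLin (quot_smul_eq_zero hs)).trans (map_zero _))).2.1
    omega
  · rintro rfl
    exact hE.shift _

end ResidueField

/-! ### Counting hulls by the dimension of the socle -/

section Socle

/-- Each hull of k(-z) contributes one copy of k to the socle in degree z, and every other summand
contributes nothing. -/
theorem HullDecomposition.exists_socle_parametrization (hk : IsField (R ⧸ m.toIdeal))
    {Q : GrMod 𝒜} {J : Type u} (D : Q.HullDecomposition J) (z : ℤ) :
    ∃ Φ : ({j : J // (D.summand j).IsHullOf ((quot m).shift (-z))} →₀ R ⧸ m.toIdeal) →ₗ[R] Q,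
      Function.Injective Φ ∧
      ∀ x, x ∈ LinearMap.range Φ ↔ x ∈ Q.gr z ∧ ∀ s ∈ m.toIdeal, s • x = 0 := by
  let _ := Classical.decEq J
  have hprime := (Ideal.Quotient.maximal_of_isField _ hk).isPrime
  let J' := {j : J // (D.summand j).IsHullOf ((quot m).shift (-z))}
  have hhull : ∀ j : J', ∃ φ : Hom ((quot m).shift (-z)) (D.summand j),
    IsStarInjectiveHull φ := fun j => j.2
  choose φ hφ using hhull
  let φ' : ∀ j : J', R ⧸ m.toIdeal →ₗ[R] D.summand j := fun j => (φ j).toLin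
  let T := DirectSum.toModule R J Q (fun j => (D.incl j).toLin)
  have hT : Function.Bijective T := D.bijective
  let Ψ : (J' →₀ R ⧸ m.toIdeal) →ₗ[R] DirectSum J fun j => D.summand j :=
    Finsupp.lsum R fun j => (DirectSum.lof R J (fun j => D.summand j) j).comp (φ' j)
  have hΨ : ∀ j a, Ψ (Finsupp.single j a) = DirectSum.lof R J _ j.1 (φ' j a) := fun j a => by
    simp [Ψ]
  have hΨ' : ∀ c (j : J'), Ψ c j.1 = φ' j (c j) := by
    intro c j
    induction c using Finsupp.induction_linear with
    | zero => simp
    | add c d hc hd => simp [hc, hd]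
    | single l a =>
      rw [hΨ]
      by_cases h : l = j
      · subst h
        rw [DirectSum.lof_apply, Finsupp.single_eq_same]
      · rw [DirectSum.lof_eq_of, DirectSum.of_eq_of_ne _ _ _ (fun h' => h (Subtype.ext h'.symm)),
          Finsupp.single_eq_of_ne' h, map_zero]
  refine ⟨T.comp Ψ, hT.1.comp ?_, fun x => ⟨?_, ?_⟩⟩
  · intro c d hcd
    refine Finsupp.ext fun j => (hφ j).injective ?_
    exact (hΨ' c j).symm.trans ((congrArg (· j.1) hcd).trans (hΨ' d j))
  · rintro ⟨c, rfl⟩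
    constructor
    · induction c using Finsupp.induction_linear with
      | zero => rw [map_zero]; exact zero_mem _
      | add c d hc hd => rw [map_add]; exact add_mem hc hd
      | single j a =>
        rw [LinearMap.comp_apply, hΨ, DirectSum.toModule_lof]
        refine (D.incl j).map_mem z _ ((φ j).map_mem z a ?_)
        change a ∈ (quot m).gr (z + -z)
        rw [add_neg_cancel]
        exact quot_mem_gr_zero hk a
    · intro s hs
      rw [← map_smul]
      have : s • c = 0 := Finsupp.ext fun j => quot_smul_eq_zero hs
      rw [this, map_zero]
  · rintro ⟨hx, hxm⟩
    obtain ⟨y, rfl⟩ := hT.2 x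
    -- The decomposition respects degrees, so the summand components of a socle element of degree
    -- `z` are again socle elements of degree `z`.
    have hproj : ∀ y, T (DirectSum.map (fun j => (D.summand j).proj z) y) = Q.proj z (T y) := by
      intro y
      induction y using DirectSum.induction_on with
      | zero => simp
      | add x y hx hy => simp only [map_add, hx, hy]
      | of i y =>
        rw [DirectSum.map_of, ← DirectSum.lof_eq_of R, ← DirectSum.lof_eq_of R,
          DirectSum.toModule_lof, DirectSum.toModule_lof, (D.incl i).map_proj]
    have hy : ∀ j, y j ∈ (D.summand j).gr z := by
      intro j
      have h1 : DirectSum.map (fun j => (D.summand j).proj z) y = y :=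
        hT.1 (by rw [hproj, Q.proj_same hx])
      exact (mem_gr_iff_proj _).2 (congrArg (· j) h1)
    have hym : ∀ j, ∀ s ∈ m.toIdeal, s • y j = 0 := by
      intro j s hs
      have h1 : s • y = 0 := hT.1 (by rw [map_smul, hxm s hs, map_zero])
      rw [← DirectSum.smul_apply, h1, DirectSum.zero_apply]
    rw [LinearMap.range_comp]
    refine Submodule.mem_map_of_mem ?_
    classical
    rw [← DirectSum.sum_support_of y]
    refine sum_mem fun j hj => ?_
    have hj0 : y j ≠ 0 := DFinsupp.mem_support_iff.1 hj
    obtain ⟨q, k, hq, χ, hχ⟩ := D.isHull j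
    obtain ⟨rfl, rfl, -⟩ := hχ.socle hk hq (hy j) hj0 (hym j)
    let j' : J' := ⟨j, χ, hχ⟩
    obtain ⟨-, -, a, ha⟩ := (hφ j').socle hk hq (hy j) hj0 (hym j)
    exact ⟨Finsupp.single j' a, (hΨ j' a).trans (congrArg (DirectSum.lof R J _ j) ha)⟩

theorem HullDecomposition.mk_eq_of_bijective (hk : IsField (R ⧸ m.toIdeal)) {Q Q' : GrMod 𝒜}
    (ψ : Hom Q Q') (hψ : Function.Bijective ψ.toLin) {J J' : Type u} (D : Q.HullDecomposition J)
    (D' : Q'.HullDecomposition J') (z : ℤ) :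
    Cardinal.mk {j : J // (D.summand j).IsHullOf ((quot m).shift (-z))} =
      Cardinal.mk {j : J' // (D'.summand j).IsHullOf ((quot m).shift (-z))} := by
  obtain ⟨Φ, hΦ, hr⟩ := D.exists_socle_parametrization hk z
  obtain ⟨Φ', hΦ', hr'⟩ := D'.exists_socle_parametrization hk z
  have hmap : (LinearMap.range Φ).map ψ.toLin = LinearMap.range Φ' := by
    ext x
    obtain ⟨y, rfl⟩ := hψ.2 x
    rw [hr', Submodule.mem_map]
    constructor
    · rintro ⟨y', hy', h⟩
      obtain rfl := hψ.1 h
      obtain ⟨h1, h2⟩ := (hr _).1 hy'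
      exact ⟨ψ.map_mem z _ h1, fun s hs => by rw [← map_smul, h2 s hs, map_zero]⟩
    · rintro ⟨h1, h2⟩
      refine ⟨y, (hr _).2 ⟨ψ.mem_gr_of_map_mem hψ.1 h1, fun s hs => hψ.1 ?_⟩, rfl⟩
      rw [map_smul, h2 s hs, map_zero]
  have : Nontrivial (R ⧸ m.toIdeal) := hk.nontrivial
  let e := (LinearEquiv.ofInjective Φ hΦ).trans
    (((LinearEquiv.ofBijective ψ.toLin hψ).submoduleMap (LinearMap.range Φ)).trans
      ((LinearEquiv.ofEq _ _ hmap).trans (LinearEquiv.ofInjective Φ' hΦ').symm))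
  -- Both sides are free over the field `R/m`, so the index sets have the cardinality of the common
  -- dimension.
  have := (e.extendScalarsOfSurjective (S := R ⧸ m.toIdeal) Ideal.Quotient.mk_surjective).rank_eq
  rwa [rank_finsupp_self', rank_finsupp_self'] at this

end Socle

/-! ### Uniqueness of minimal *injective resolutions -/

section Uniqueness

theorem IsStarEssential.injective {N N' : GrMod 𝒜} {L : Submodule R N}
    (hN : N.IsStarEssential L) (f : Hom N N') (h : ∀ x ∈ L, f.toLin x = 0 → x = 0) :
    Function.Injective f.toLin := by
  rw [← LinearMap.ker_eq_bot]
  by_contra hne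
  obtain ⟨x, hx, hx0⟩ := Submodule.exists_mem_ne_zero_of_ne_bot
    (hN ⟨LinearMap.ker f.toLin, fun i x hx => ker_proj_mem f i x hx⟩ hne)
  exact hx0 (h x hx.2 hx.1)

/-- One step in the comparison of two minimal *injective resolutions. -/
theorem exists_bijective_of_essential {P P' Q Q' S S' : GrMod 𝒜} {φ : Hom P P'}
    (hφ : Function.Surjective φ.toLin) {f : Hom P Q} {f' : Hom P' Q'} {g : Hom Q S}
    {g' : Hom Q' S'} (hQ : Q.IsStarInjective) (hQ' : Q'.IsStarInjective)
    (he : Q.IsStarEssential (LinearMap.range f.toLin))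
    (he' : Q'.IsStarEssential (LinearMap.range f'.toLin))
    (hfg : Function.Exact f.toLin g.toLin) (hfg' : Function.Exact f'.toLin g'.toLin)
    (hker : ∀ x, f.toLin x = 0 ↔ f'.toLin (φ.toLin x) = 0) :
    ∃ ψ : Hom Q Q', Function.Bijective ψ.toLin ∧
      ∀ x, g.toLin x = 0 ↔ g'.toLin (ψ.toLin x) = 0 := by
  obtain ⟨ψ, hψ⟩ := hQ'.exists_factor f (f'.comp φ) fun x => (hker x).1
  have hψ' : ∀ x, ψ.toLin (f.toLin x) = f'.toLin (φ.toLin x) := hψ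
  have hinj : Function.Injective ψ.toLin := by
    refine he.injective ψ ?_
    rintro _ ⟨x, rfl⟩ hx
    rw [hψ'] at hx
    exact (hker x).2 hx
  -- Injectivity of `Q` gives a retraction of `ψ`; essentiality of `Q'` makes it injective, which
  -- forces `ψ` to be surjective.
  obtain ⟨r, hr⟩ := hQ.exists_factor ψ (Hom.id Q) fun x hx => hinj (hx.trans (map_zero _).symm)
  have hr' : ∀ x, r.toLin (ψ.toLin x) = x := hr
  have hrinj : Function.Injective r.toLin := by
    refine he'.injective r ?_
    rintro _ ⟨x, rfl⟩ hx
    obtain ⟨y, rfl⟩ := hφ x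
    rw [← hψ', hr'] at hx
    exact (hker y).1 hx
  refine ⟨ψ, ⟨hinj, fun y => ⟨r.toLin y, hrinj (hr' _)⟩⟩, fun x => ⟨fun hx => ?_, fun hx => ?_⟩⟩
  · obtain ⟨y, rfl⟩ := (hfg x).1 hx
    rw [hψ']
    exact hfg'.apply_apply_eq_zero _
  · obtain ⟨y, hy⟩ := (hfg' _).1 hx
    obtain ⟨w, rfl⟩ := hφ y
    rw [← hψ'] at hy
    rw [← hinj hy]
    exact hfg.apply_apply_eq_zero _

end Uniqueness

end GrMod

/-! ### Resolutions, Betti numbers and Bass numbers -/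

theorem RightSeq.IsMinimalInjectiveResolution.exists_bijective {N : GrMod 𝒜} {I I' : RightSeq N}
    (hI : I.IsMinimalInjectiveResolution) (hI' : I'.IsMinimalInjectiveResolution) (i : ℕ) :
    ∃ ψ : Hom (I.X i) (I'.X i), Function.Bijective ψ.toLin ∧
      ∀ x, (I.d i).toLin x = 0 ↔ (I'.d i).toLin (ψ.toLin x) = 0 := by
  induction i with
  | zero =>
    refine exists_bijective_of_essential (φ := Hom.id N) Function.surjective_id
      (hI.starInjective 0) (hI'.starInjective 0) hI.essential_zero hI'.essential_zero
      hI.exact_zero hI'.exact_zero fun x => ?_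
    exact (map_eq_zero_iff _ hI.injective).trans (map_eq_zero_iff _ hI'.injective).symm
  | succ i ih =>
    obtain ⟨φ, hφ, hker⟩ := ih
    exact exists_bijective_of_essential hφ.2 (hI.starInjective _) (hI'.starInjective _)
      (hI.essential_succ i) (hI'.essential_succ i) (hI.exact_succ i) (hI'.exact_succ i) hker

/-- Graded Bass numbers at `m` do not depend on the resolution or the decomposition. -/
theorem IsGradedBass.unique (hk : IsField (R ⧸ m.toIdeal)) {i : ℕ} {z : ℤ} {N : GrMod 𝒜}
    {c c' : Cardinal.{u}} (h : IsGradedBass i m z N c) (h' : IsGradedBass i m z N c') : c = c' := by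
  obtain ⟨I, hI, J, D, rfl⟩ := h
  obtain ⟨I', hI', J', D', rfl⟩ := h'
  obtain ⟨ψ, hψ, -⟩ := hI.exists_bijective hI' i
  exact D.mk_eq_of_bijective hk ψ hψ D' z

/-- By exactness and minimality the kernel of each map out of `F.X i` lies in `m F_i`; its image is
finitely generated, being `M` or a submodule of a finite module over a Noetherian ring. -/
theorem LeftSeq.IsMinimalFreeResolution.finite [IsNoetherianRing R] {M : GrMod 𝒜} {F : LeftSeq M}
    (hF : F.IsMinimalFreeResolution m) (hm : m.toIdeal ≠ ⊤) (hM : M.IsStarNoetherian) (i : ℕ)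
    {J : Type u} (b : (F.X i).HomogeneousBasis J) : Finite J := by
  induction i generalizing J with
  | zero =>
    have := hM.finite
    refine b.basis.finite_of_ker_le_smul F.aug.toLin ?_ hm ?_
    · rw [LinearMap.range_eq_top.2 hF.surjective]
      exact Module.Finite.fg_top
    · rw [LinearMap.exact_iff.1 hF.exact_zero]
      exact hF.minimal 0
  | succ i ih =>
    obtain ⟨J', ⟨b'⟩⟩ := hF.free i
    have := ih b'
    have := Module.Finite.of_basis b'.basis
    refine b.basis.finite_of_ker_le_smul (F.d i).toLin (IsNoetherian.noetherian _) hm ?_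
    rw [LinearMap.exact_iff.1 (hF.exact_succ i)]
    exact hF.minimal (i + 1)

theorem LeftSeq.IsMinimalFreeResolution.dual [IsNoetherianRing R] {M : GrMod 𝒜} {F : LeftSeq M}
    (hF : F.IsMinimalFreeResolution m) (hm : m.toIdeal ≠ ⊤) (hM : M.IsStarNoetherian)
    {E : GrMod 𝒜} (hE : E.IsHullOf (GrMod.quot m)) :
    (F.dual E).IsMinimalInjectiveResolution where
  starInjective i := hE.choose_spec.starInjective.starHom (hF.free i)
  injective := starHomMap_injective E F.aug hF.surjective
  exact_zero := starHomMap_exact hE.choose_spec.starInjective _ _ hF.exact_zero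
  exact_succ i := starHomMap_exact hE.choose_spec.starInjective _ _ (hF.exact_succ i)
  essential_zero := by
    obtain ⟨J, ⟨b⟩⟩ := hF.free 0
    have := hF.finite hm hM 0 b
    exact b.starHom_isStarEssential hE (F.d 0) F.aug hF.exact_zero (hF.minimal 0)
  essential_succ i := by
    obtain ⟨J, ⟨b⟩⟩ := hF.free (i + 1)
    have := hF.finite hm hM (i + 1) b
    exact b.starHom_isStarEssential hE (F.d (i + 1)) (F.d i) (hF.exact_succ i) (hF.minimal (i + 1))

/-- A graded Betti number of `M` is a graded Bass number of the graded Matlis dual of `M`. -/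
theorem IsGradedBetti.isGradedBass [IsNoetherianRing R] (hk : IsField (R ⧸ m.toIdeal))
    {E : GrMod 𝒜} (hE : E.IsHullOf (GrMod.quot m)) {M : GrMod 𝒜} (hM : M.IsStarNoetherian)
    {i : ℕ} {z : ℤ} {c : Cardinal.{u}} (h : IsGradedBetti m i M (-z) c) :
    IsGradedBass i m z (M.starHom E) c := by
  obtain ⟨F, hF, J, b, rfl⟩ := h
  have hprime := (Ideal.Quotient.maximal_of_isField _ hk).isPrime
  have := hF.finite hprime.ne_top hM i b
  refine ⟨F.dual E, hF.dual hprime.ne_top hM hE, J, b.hullDecomposition hprime hE, ?_⟩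
  exact Cardinal.mk_congr (Equiv.subtypeEquivRight fun j =>
    (shift_isHullOf_iff hk hE (b.deg j) z).symm)

end GradedMatlis

theorem mainTheorem6 {R : Type u} [CommRing R] [IsNoetherianRing R]
    (𝒜 : ℤ → AddSubgroup R) [GradedRing 𝒜]
    (m : HomogeneousIdeal 𝒜) (hm : IsStarLocal m) (hk : IsField (R ⧸ m.toIdeal))
    (E : GrMod 𝒜) (hE : E.IsHullOf (GrMod.quot m))
    (M : GrMod 𝒜) (hM : M.IsStarNoetherian)
    (F : LeftSeq M) (hF : F.IsMinimalFreeResolution m) :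
    (F.dual E).IsMinimalInjectiveResolution ∧
    ∀ (i : ℕ) (z : ℤ), ∃ β : Cardinal.{u},
      (∀ c, IsGradedBetti m i M (-z) c ↔ c = β) ∧
      (∀ c, IsGradedBass i m z (M.starHom E) c ↔ c = β) := by
  have hne : m.toIdeal ≠ ⊤ := (Ideal.Quotient.maximal_of_isField _ hk).ne_top
  refine ⟨hF.dual hne hM hE, fun i z => ?_⟩
  obtain ⟨J, ⟨b⟩⟩ := hF.free i
  have hβ : IsGradedBetti m i M (-z) (Cardinal.mk {j : J // b.deg j = -z}) := ⟨F, hF, J, b, rfl⟩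
  have hβ' := hβ.isGradedBass hk hE hM
  -- Any Betti value is also a Bass value of the dual, so uniqueness of Bass numbers settles both
  -- counts.
  refine ⟨_, fun c => ⟨fun h => (h.isGradedBass hk hE hM).unique hk hβ', ?_⟩,
    fun c => ⟨fun h => h.unique hk hβ', ?_⟩⟩
  · rintro rfl
    exact hβ
  · rintro rfl
    exact hβ'
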